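/- Let $\mathbb{D}=\{\lambda\in\mathbb{C}:|\lambda|<1\}$. A function $u:\mathbb{D}\to[0,\infty)$ is called inf-harmonic if there is a family $\mathcal{H}$ of harmonic functions on $\mathbb{D}$ with $u(\lambda)=\inf_{h\in\mathcal{H}}h(\lambda)$ for all $\lambda\in\mathbb{D}$. A holomorphic motion of a set $A\subset\mathbb{C}$ (in the plane) is a map $f:\mathbb{D}\times A\to\mathbb{C}$, $f_\lambda(z):=f(\lambda,z)$, such that $\lambda\mapsto f_\lambda(z)$ is holomorphic on $\mathbb{D}$ for each $z\in A$, $f_\lambda$ is injective on $A$ for each $\lambda\in\mathbb{D}$, and $f_0(z)=z$ for all $z\in A$. **Theorem.** Let $d:\mathbb{D}\to(0,2]$ be a function such that $1/d$ is inf-harmonic on $\mathbb{D}$. Then there exist a compact set $A\subset\mathbb{C}$ and a holomorphic motion $f:\mathbb{D}\times A\to\mathbb{C}$ such that, setting $A_\lambda:=f_\lambda(A)$, the packing dimension and the Hausdorff dimension of $A_\lambda$ satisfy $$\dim_P(A_\lambda)=\dim_H(A_\lambda)=d(\lambda)\qquad\text{for all }\lambda\in\mathbb{D}.$$ -/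

import Mathlib

open Set Metric
open scoped ENNReal NNReal

noncomputable section

namespace HoloMotion

/-- The open unit disk `𝔻` of the complex plane. -/
abbrev unitDisk : Set ℂ := ball 0 1

/-- `f : 𝔻 × A → ℂ`, `(w, z) ↦ f w z`, is a holomorphic motion of `A ⊆ ℂ` (in the plane).
Only the values of `f w z` with `w ∈ 𝔻` and `z ∈ A` are relevant. -/
structure IsHolomorphicMotion (A : Set ℂ) (f : ℂ → ℂ → ℂ) : Prop where
  holomorphic : ∀ z ∈ A, DifferentiableOn ℂ (fun w => f w z) unitDisk
  injective : ∀ w ∈ unitDisk, InjOn (f w) A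
  base : ∀ z ∈ A, f 0 z = z

/-- `u : D → [0, ∞)` is inf-harmonic on the plane domain `D`: it is nonnegative on `D` and is
the pointwise infimum on `D` of a family of real-valued harmonic functions on `D`.
(The empty family is excluded automatically, as `∅` has no greatest lower bound in `ℝ`.) -/
def IsInfHarmonicOn (u : ℂ → ℝ) (D : Set ℂ) : Prop :=
  (∀ w ∈ D, 0 ≤ u w) ∧
    ∃ H : Set (ℂ → ℝ), (∀ h ∈ H, InnerProductSpace.HarmonicOnNhd h D) ∧
      ∀ w ∈ D, IsGLB ((fun h : ℂ → ℝ => h w) '' H) (u w)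

/-- `P` is a finite `δ`-packing of `A`: a finite set of pairwise disjoint closed disks, given as
pairs (centre, radius), with centres in `A`, positive radii and diameters at most `δ`. -/
def IsPacking (δ : ℝ) (A : Set ℂ) (P : Finset (ℂ × ℝ)) : Prop :=
  (∀ p ∈ P, p.1 ∈ A ∧ 0 < p.2 ∧ 2 * p.2 ≤ δ) ∧
    (P : Set (ℂ × ℝ)).PairwiseDisjoint (fun p => closedBall p.1 p.2)

/-- `𝒫^s_δ(A)`: the supremum of `∑ diam(D_j)^s` over the finite `δ`-packings `{D_j}` of `A`. -/
def packingSup (s δ : ℝ) (A : Set ℂ) : ℝ≥0∞ :=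
  ⨆ (P : Finset (ℂ × ℝ)) (_ : IsPacking δ A P), ∑ p ∈ P, ENNReal.ofReal ((2 * p.2) ^ s)

/-- The `s`-dimensional pre-packing measure `𝒫₀^s(A) = lim_{δ → 0} 𝒫^s_δ(A)`; the limit is an
infimum because `𝒫^s_δ(A)` decreases as `δ` decreases. -/
def prePackingMeasure (s : ℝ) (A : Set ℂ) : ℝ≥0∞ :=
  ⨅ (δ : ℝ) (_ : 0 < δ), packingSup s δ A

/-- The `s`-dimensional packing measure: the infimum of `∑ 𝒫₀^s(A_j)` over all countable
decompositions `A = ⋃ A_j`. -/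
def packingMeasure (s : ℝ) (A : Set ℂ) : ℝ≥0∞ :=
  ⨅ (B : ℕ → Set ℂ) (_ : A = ⋃ j, B j), ∑' j, prePackingMeasure s (B j)

/-- The packing dimension: the value of `s` at which `𝒫^s(A)` jumps from `∞` to `0`, that is, the
supremum of the `s ≥ 0` with `𝒫^s(A) = ∞` (compare `dimH`). -/
def packingDim (A : Set ℂ) : ℝ≥0∞ :=
  ⨆ (s : ℝ≥0) (_ : packingMeasure s A = ∞), (s : ℝ≥0∞)

end HoloMotion

end

/-!
Let `1 / d = inf h` over a family of harmonic functions. By Lindelöf's theorem a countable subfamily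
has the same infimum, and each of its members is the real part of a holomorphic function on the
disk. Adding small constants gives holomorphic `g k` with `Re (g k) ≥ 1 / d + ε k` on the disk and
`inf Re (g k) = 1 / d` (`IsInfHarmonicOn.exists_seq_holomorphic_add_le`).

For each `k` take a large `m` and the self-similar set of all sums `∑ aˡ b(xₗ)`, where the `m²`
digits `b` are the points of a square grid of mesh `1 / m` and the base is
`a(w) = exp (-2 log m · g k w)`, holomorphic in `w`. Since `d ≤ 2`, one has
`|a| ≤ m ^ (-1 - 2 ε k)`, which for large `m` is small compared with the mesh
(`exists_grid_size`); the sums are then distinct for distinct words and the set has dimension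
`log m² / log (1 / |a|) = 1 / Re (g k w)`. For fixed words the sums are holomorphic in `w`, so this
is a holomorphic motion. Copies of these sets, placed in disjoint disks `D(2⁻ᵏ, 2⁻ᵏ / 16)`
accumulating at `0`, together with the point `0`, form a compact set whose dimension is
`sup 1 / Re (g k w) = d w` by countable stability.

It remains to justify the dimension of one such set. Reading the digits of a word in base `m²` gives
a Hölder map onto `[0, 1]`, hence the lower bound for the Hausdorff dimension
(`IsCantorCoding.le_dimH`). Disjoint disks centred on the set contain images of disjoint cylinders,
so Kraft's inequality bounds the packing sums and gives the upper bound for the packing dimension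
(`IsCantorCoding.prePackingMeasure_eq_zero`). Finally `dimH ≤ packingDim` on bounded sets
(`dimH_le_packingDim`), so both dimensions agree.
-/

namespace HoloMotion


/-! ### Packing dimension dominates Hausdorff dimension -/

theorem packingSup_mono_delta {s δ δ' : ℝ} (h : δ ≤ δ') (A : Set ℂ) :
    packingSup s δ A ≤ packingSup s δ' A := by
  refine iSup₂_le fun P hP => le_iSup₂_of_le P ?_ le_rfl
  exact ⟨fun p hp => ⟨(hP.1 p hp).1, (hP.1 p hp).2.1, (hP.1 p hp).2.2.trans h⟩, hP.2⟩

/-- The disks of radius `δ / 2` about a maximal `δ`-separated set form a packing, and those of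
radius `δ` a cover with the same number of members. -/
theorem exists_cover_le_packingSup {s : ℝ} (hs : 0 ≤ s) {δ : ℝ} (hδ : 0 < δ) {A : Set ℂ}
    (hA : Bornology.IsBounded A) :
    ∃ C : Finset ℂ, A ⊆ ⋃ i : C, closedBall (i : ℂ) δ ∧
      ∑ i : C, ediam (closedBall (i : ℂ) δ) ^ s ≤ ENNReal.ofReal (2 ^ s) * packingSup s δ A := by
  set ε : ℝ≥0 := ⟨δ, hδ.le⟩
  have hε0 : ε ≠ 0 := fun h => hδ.ne' (congrArg NNReal.toReal h)
  have hed : ∀ x y : ℂ, edist x y ≤ (ε : ℝ≥0∞) ↔ dist x y ≤ δ := fun x y => by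
    rw [edist_le_coe, ← NNReal.coe_le_coe, coe_nndist]
    rfl
  have hfin : packingNumber ε A ≠ ⊤ := by
    have h1 : externalCoveringNumber (ε / 2) A ≠ ⊤ := by
      obtain ⟨t, -, ht, hc⟩ := exists_finite_isCover_of_totallyBounded (ε := ε / 2)
        (div_ne_zero hε0 two_ne_zero)
        (hA.isCompact_closure.totallyBounded.subset subset_closure)
      exact ne_top_of_le_ne_top (by simpa using ht) hc.externalCoveringNumber_le_encard
    have h2 := packingNumber_two_mul_le_externalCoveringNumber (ε / 2) A
    rw [mul_div_cancel₀ _ (two_ne_zero)] at h2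
    exact ne_top_of_le_ne_top h1 h2
  obtain ⟨hsub, hsep, hcov⟩ : maximalSeparatedSet ε A ⊆ A ∧ IsSeparated ε (maximalSeparatedSet ε A)
      ∧ IsCover ε A (maximalSeparatedSet ε A) :=
    ⟨maximalSeparatedSet_subset, isSeparated_maximalSeparatedSet, isCover_maximalSeparatedSet hfin⟩
  have hCfin : (maximalSeparatedSet ε A).Finite := by
    rw [← encard_ne_top_iff, encard_maximalSeparatedSet hfin]
    exact hfin
  refine ⟨hCfin.toFinset, ?_, ?_⟩
  · intro x hx
    obtain ⟨y, hy, hxy⟩ := hcov hx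
    refine mem_iUnion.2 ⟨⟨y, by simpa using hy⟩, ?_⟩
    change edist x y ≤ _ at hxy
    exact (hed x y).1 hxy
  · have hinj : Function.Injective fun z : ℂ => (z, δ / 2) := fun a b h => congrArg Prod.fst h
    have hpack : IsPacking δ A (hCfin.toFinset.map ⟨_, hinj⟩) := by
      constructor
      · intro p hp
        obtain ⟨z, hz, rfl⟩ := Finset.mem_map.1 hp
        refine ⟨hsub (hCfin.mem_toFinset.1 hz), half_pos hδ, ?_⟩
        change 2 * (δ / 2) ≤ δ
        linarith
      · intro p hp q hq hpq
        obtain ⟨z, hz, rfl⟩ := Finset.mem_map.1 hp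
        obtain ⟨z', hz', rfl⟩ := Finset.mem_map.1 hq
        have hne : z ≠ z' := by rintro rfl; exact hpq rfl
        have h1 : (ε : ℝ≥0∞) < edist z z' :=
          hsep (hCfin.mem_toFinset.1 hz) (hCfin.mem_toFinset.1 hz') hne
        rw [← not_le, hed, not_le] at h1
        refine closedBall_disjoint_closedBall ?_
        change δ / 2 + δ / 2 < dist z z'
        linarith
    have h2 : ∑ p ∈ hCfin.toFinset, ENNReal.ofReal ((2 * (δ / 2)) ^ s) ≤ packingSup s δ A := by
      refine le_trans (le_of_eq ?_) (le_iSup₂_of_le _ hpack le_rfl)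
      rw [Finset.sum_map]
      rfl
    calc ∑ i : hCfin.toFinset, ediam (closedBall (i : ℂ) δ) ^ s
        ≤ ∑ i : hCfin.toFinset, ENNReal.ofReal (2 ^ s) * ENNReal.ofReal ((2 * (δ / 2)) ^ s) := by
          refine Finset.sum_le_sum fun i _ => ?_
          rw [← ENNReal.ofReal_mul (by positivity), ← Real.mul_rpow (by norm_num) (by positivity),
            ← ENNReal.ofReal_rpow_of_nonneg (by positivity) hs]
          refine ENNReal.rpow_le_rpow ?_ hs
          rw [show 2 * (2 * (δ / 2)) = 2 * δ by ring, ENNReal.ofReal_mul (by norm_num)]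
          rw [← Metric.closedEBall_ofReal hδ.le]
          refine ediam_closedEBall_le.trans (by simp)
      _ = ENNReal.ofReal (2 ^ s) * ∑ p ∈ hCfin.toFinset, ENNReal.ofReal ((2 * (δ / 2)) ^ s) := by
          rw [← Finset.mul_sum]
          simp
      _ ≤ _ := by gcongr

open MeasureTheory Filter Topology in
theorem hausdorffMeasure_le_prePackingMeasure {s : ℝ} (hs : 0 ≤ s) {A : Set ℂ}
    (hA : Bornology.IsBounded A) :
    μH[s] A ≤ ENNReal.ofReal (2 ^ s) * prePackingMeasure s A := by
  choose C hC hsum using fun n : ℕ =>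
    exists_cover_le_packingSup hs (δ := 1 / ((n : ℝ) + 1)) (by positivity) hA
  have h0 : Tendsto (fun n : ℕ => ENNReal.ofReal (2 * (1 / ((n : ℝ) + 1)))) atTop (𝓝 0) := by
    have := ENNReal.tendsto_ofReal ((tendsto_one_div_add_atTop_nhds_zero_nat (𝕜 := ℝ)).const_mul 2)
    simpa using this
  have h1 := Measure.hausdorffMeasure_le_liminf_sum s A
    (fun n : ℕ => ENNReal.ofReal (2 * (1 / ((n : ℝ) + 1)))) h0
    (fun n (i : C n) => closedBall (i : ℂ) (1 / ((n : ℝ) + 1)))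
    (Eventually.of_forall fun n i => by
      rw [ENNReal.ofReal_mul (by norm_num), ← Metric.closedEBall_ofReal (by positivity)]
      exact ediam_closedEBall_le.trans (by simp)) (Eventually.of_forall hC)
  refine h1.trans ?_
  have hne : ENNReal.ofReal (2 ^ s) ≠ 0 := by
    have : (0 : ℝ) < 2 ^ s := by positivity
    simpa using this
  unfold prePackingMeasure
  rw [ENNReal.mul_iInf_of_ne hne ENNReal.ofReal_ne_top]
  refine le_iInf fun δ => ?_
  rw [ENNReal.mul_iInf_of_ne hne ENNReal.ofReal_ne_top]
  refine le_iInf fun hδ => ?_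
  refine Filter.liminf_le_of_frequently_le' (Eventually.frequently ?_)
  filter_upwards [(tendsto_one_div_add_atTop_nhds_zero_nat (𝕜 := ℝ)).eventually_lt_const hδ]
    with n hn
  refine (hsum n).trans ?_
  gcongr
  exact packingSup_mono_delta hn.le A

theorem dimH_le_packingDim {A : Set ℂ} (hA : Bornology.IsBounded A) :
    dimH A ≤ packingDim A := by
  refine dimH_le fun s hs => ?_
  refine le_iSup₂_of_le s ?_ le_rfl
  by_contra hne
  -- A finite packing measure would make the Hausdorff measure finite.
  obtain ⟨B, hB⟩ : ∃ B : ℕ → Set ℂ, ∃ _ : A = ⋃ j, B j, ∑' j, prePackingMeasure s (B j) < ∞ := by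
    simpa only [packingMeasure, iInf_lt_iff] using lt_top_iff_ne_top.2 hne
  obtain ⟨hAB, hsum⟩ := hB
  have : MeasureTheory.Measure.hausdorffMeasure (s : ℝ) A ≤
      ENNReal.ofReal (2 ^ (s : ℝ)) * ∑' j, prePackingMeasure s (B j) := by
    rw [← ENNReal.tsum_mul_left]
    conv_lhs => rw [hAB]
    refine (MeasureTheory.measure_iUnion_le _).trans (ENNReal.tsum_le_tsum fun j => ?_)
    exact hausdorffMeasure_le_prePackingMeasure s.2
      (hA.subset (hAB ▸ subset_iUnion B j))
  rw [hs, top_le_iff] at this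
  exact (ENNReal.mul_lt_top ENNReal.ofReal_lt_top hsum).ne this

theorem packingSup_singleton_le {s δ : ℝ} (hs : 0 ≤ s) (z : ℂ) :
    packingSup s δ {z} ≤ ENNReal.ofReal (δ ^ s) := by
  refine iSup₂_le fun P hP => ?_
  have hcard : P.card ≤ 1 := by
    refine Finset.card_le_one.2 fun p hp q hq => ?_
    by_contra hpq
    have hdisj : Disjoint (closedBall p.1 p.2) (closedBall q.1 q.2) := hP.2 hp hq hpq
    refine Set.disjoint_left.1 hdisj (?_ : z ∈ _) ?_
    · exact mem_singleton_iff.1 (hP.1 p hp).1 ▸ mem_closedBall_self (hP.1 p hp).2.1.le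
    · exact mem_singleton_iff.1 (hP.1 q hq).1 ▸ mem_closedBall_self (hP.1 q hq).2.1.le
  calc ∑ p ∈ P, ENNReal.ofReal ((2 * p.2) ^ s) ≤ ∑ p ∈ P, ENNReal.ofReal (δ ^ s) := by
        refine Finset.sum_le_sum fun p hp => ENNReal.ofReal_le_ofReal ?_
        have := hP.1 p hp
        exact Real.rpow_le_rpow (by linarith) this.2.2 hs
    _ = P.card * ENNReal.ofReal (δ ^ s) := by simp
    _ ≤ 1 * ENNReal.ofReal (δ ^ s) := by gcongr; exact_mod_cast hcard
    _ = _ := one_mul _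

open Filter Topology in
theorem prePackingMeasure_eq_zero_of_le {s t K δ₀ : ℝ} (ht : 0 < t) (hδ₀ : 0 < δ₀) {A : Set ℂ}
    (h : ∀ δ, 0 < δ → δ ≤ δ₀ → packingSup s δ A ≤ ENNReal.ofReal (K * δ ^ t)) :
    prePackingMeasure s A = 0 := by
  have h1 : Tendsto (fun δ : ℝ => ENNReal.ofReal (K * δ ^ t)) (𝓝[>] 0) (𝓝 0) := by
    have : Tendsto (fun δ : ℝ => δ ^ t) (𝓝[>] 0) (𝓝 0) := by
      have := (Real.continuous_rpow_const ht.le).tendsto (0 : ℝ)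
      rw [Real.zero_rpow ht.ne'] at this
      exact this.mono_left nhdsWithin_le_nhds
    simpa using ENNReal.tendsto_ofReal (this.const_mul K)
  refine le_antisymm (ge_of_tendsto h1 ?_) zero_le
  filter_upwards [Ioc_mem_nhdsGT hδ₀] with δ hδ
  exact (iInf₂_le δ hδ.1).trans (h δ hδ.1 hδ.2)

theorem prePackingMeasure_singleton {s : ℝ} (hs : 0 < s) (z : ℂ) :
    prePackingMeasure s {z} = 0 :=
  prePackingMeasure_eq_zero_of_le (K := 1) hs one_pos fun δ _ _ => by
    simpa using packingSup_singleton_le hs.le z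

theorem packingDim_insert_iUnion_le {d : ℝ≥0∞} (z : ℂ) (K : ℕ → Set ℂ)
    (h : ∀ s : ℝ≥0, d < s → ∀ j, prePackingMeasure s (K j) = 0) :
    packingDim (insert z (⋃ j, K j)) ≤ d := by
  refine iSup₂_le fun s hs => ?_
  by_contra! hlt
  have hs0 : (0 : ℝ) < s := NNReal.coe_pos.2 (ENNReal.coe_pos.1 (pos_of_gt hlt))
  obtain ⟨B, hB0, hB⟩ : ∃ B : ℕ → Set ℂ, B 0 = {z} ∧ ∀ j, B (j + 1) = K j :=
    ⟨fun j => Nat.casesOn j {z} K, rfl, fun _ => rfl⟩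
  have hU : insert z (⋃ j, K j) = ⋃ j, B j := by
    rw [← union_iUnion_nat_succ B, hB0]
    simp only [hB]
    rfl
  have h1 : packingMeasure s (insert z (⋃ j, K j)) ≤ ∑' j, prePackingMeasure s (B j) :=
    iInf₂_le (f := fun (B' : ℕ → Set ℂ) (_ : insert z (⋃ j, K j) = ⋃ j, B' j) =>
      ∑' j, prePackingMeasure s (B' j)) B hU
  have h2 : ∀ j, prePackingMeasure s (B j) = 0 := by
    rintro (_ | j)
    · rw [hB0]
      exact prePackingMeasure_singleton hs0 z
    · rw [hB]
      exact h s hlt j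
  rw [hs, ENNReal.tsum_eq_zero.2 h2] at h1
  simp at h1


/-! ### Dimensions of symbolically coded Cantor sets -/

/-- Two infinite words over an alphabet of `n` letters which first differ at the letter `N` are
sent by `π` to points at distance between `c * r ^ N` and `C * r ^ N`; the upper bound holds for
any two words with the same first `N` letters. The letters are numbered from `0`. -/
structure IsCantorCoding {n : ℕ} (r c C : ℝ) (π : (ℕ → Fin n) → ℂ) : Prop where
  lower : ∀ x y N, (∀ i < N, x i = y i) → x N ≠ y N → c * r ^ N ≤ dist (π x) (π y)
  upper : ∀ x y N, (∀ i < N, x i = y i) → dist (π x) (π y) ≤ C * r ^ N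

theorem IsCantorCoding.exists_lower {n : ℕ} {r c C : ℝ} {π : (ℕ → Fin n) → ℂ}
    (h : IsCantorCoding r c C π) {x y : ℕ → Fin n} (hxy : x ≠ y) :
    ∃ N, (∀ i < N, x i = y i) ∧ c * r ^ N ≤ dist (π x) (π y) :=
  ⟨PiNat.firstDiff x y, fun _ hi => PiNat.apply_eq_of_lt_firstDiff hi,
    h.lower x y _ (fun _ hi => PiNat.apply_eq_of_lt_firstDiff hi) (PiNat.apply_firstDiff_ne hxy)⟩

theorem IsCantorCoding.injective {n : ℕ} {r c C : ℝ} {π : (ℕ → Fin n) → ℂ}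
    (h : IsCantorCoding r c C π) (hr : 0 < r) (hc : 0 < c) : Function.Injective π := by
  intro x y hxy
  by_contra hne
  obtain ⟨N, -, hN⟩ := h.exists_lower hne
  rw [hxy, dist_self] at hN
  have : 0 < c * r ^ N := by positivity
  linarith

theorem IsCantorCoding.affine {n : ℕ} {r c C : ℝ} {π : (ℕ → Fin n) → ℂ}
    (h : IsCantorCoding r c C π) (p : ℂ) {σ : ℝ} (hσ : 0 ≤ σ) :
    IsCantorCoding r (σ * c) (σ * C) (fun x => p + σ * π x) := by
  have key : ∀ x y, dist (p + σ * π x) (p + σ * π y) = σ * dist (π x) (π y) := fun x y => by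
    rw [dist_add_left, dist_eq_norm, ← mul_sub, norm_mul, Complex.norm_real, Real.norm_of_nonneg hσ,
      dist_eq_norm]
  refine ⟨fun x y N hN hne => ?_, fun x y N hN => ?_⟩
  · rw [key, mul_assoc]
    exact mul_le_mul_of_nonneg_left (h.lower x y N hN hne) hσ
  · rw [key, mul_assoc]
    exact mul_le_mul_of_nonneg_left (h.upper x y N hN) hσ

/-- The inverse of the coding followed by the base-`n` expansion is an `s`-Hölder map of the coded
set onto `[0, 1]`. -/
theorem IsCantorCoding.le_dimH {n : ℕ} {r c C : ℝ} {π : (ℕ → Fin n) → ℂ}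
    (h : IsCantorCoding r c C π) (hn : 1 < n) (hr : 0 < r) (hc : 0 < c)
    {s : ℝ} (hs : 0 < s) (hrs : r ^ s = (n : ℝ)⁻¹) :
    ENNReal.ofReal s ≤ dimH (range π) := by
  have : NeZero n := ⟨by lia⟩
  have hinv : ∀ x, Function.invFun π (π x) = x := Function.leftInverse_invFun (h.injective hr hc)
  set g : ℂ → ℝ := fun z => Real.ofDigits (Function.invFun π z) with hg
  have hgπ : ∀ x, g (π x) = Real.ofDigits x := fun x => by rw [hg]; simp only [hinv]
  have hold : HolderOnWith (Real.toNNReal ((c⁻¹) ^ s)) (Real.toNNReal s) g (range π) := by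
    rintro _ ⟨x, rfl⟩ _ ⟨y, rfl⟩
    rw [hgπ, hgπ]
    rcases eq_or_ne x y with rfl | hxy
    · simp
    obtain ⟨N, hN, hd⟩ := h.exists_lower hxy
    rw [edist_dist, edist_dist, Real.coe_toNNReal _ hs.le,
      ENNReal.ofReal_rpow_of_nonneg dist_nonneg hs.le]
    change _ ≤ ENNReal.ofReal _ * _
    rw [← ENNReal.ofReal_mul (by positivity)]
    refine ENNReal.ofReal_le_ofReal ?_
    rw [Real.dist_eq, ← Real.mul_rpow (by positivity) dist_nonneg]
    refine (Real.abs_ofDigits_sub_ofDigits_le hN).trans ?_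
    rw [← inv_pow, ← hrs, ← Real.rpow_natCast, ← Real.rpow_mul hr.le, mul_comm s,
      Real.rpow_mul hr.le, Real.rpow_natCast]
    refine Real.rpow_le_rpow (by positivity) ?_ hs.le
    rw [inv_mul_eq_div, le_div_iff₀ hc, mul_comm]
    exact hd
  have hsub : Icc (0 : ℝ) 1 ⊆ g '' range π := by
    intro t ht
    obtain ⟨x, -, hx⟩ := Real.ofDigits_SurjOn hn ht
    exact ⟨π x, mem_range_self x, by rw [hgπ, hx]⟩
  have h1 : (1 : ℝ≥0∞) ≤ dimH (range π) / ENNReal.ofReal s := by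
    have h2 : dimH (Icc (0 : ℝ) 1) = 1 := by
      rw [Real.dimH_of_nonempty_interior (by simp [interior_Icc])]
      simp
    rw [← h2]
    exact (dimH_mono hsub).trans (hold.dimH_image_le (by simpa using hs))
  rwa [ENNReal.le_div_iff_mul_le (by simp [hs]) (by simp), one_mul] at h1

/-- Kraft's inequality for disjoint cylinders in the space of infinite words. -/
theorem sum_inv_pow_le_one {ι : Type*} {n : ℕ} (P : Finset ι) (x : ι → ℕ → Fin n) (N : ι → ℕ)
    (hdisj : ∀ p ∈ P, ∀ q ∈ P, p ≠ q →
      ¬ ∃ y : ℕ → Fin n, (∀ k < N p, y k = x p k) ∧ ∀ k < N q, y k = x q k) :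
    ∑ p ∈ P, ((n : ℝ) ^ N p)⁻¹ ≤ 1 := by
  classical
  rcases P.eq_empty_or_nonempty with rfl | ⟨p₀, hp₀⟩
  · simp
  have hn : 0 < n := Fin.pos (x p₀ 0)
  set M := P.sup N with hM
  have hNM : ∀ p ∈ P, N p ≤ M := fun p hp => Finset.le_sup hp
  -- All words of length `M` which extend the first `N p` letters of `x p`.
  set S : ι → Finset (Fin M → Fin n) := fun p =>
    Fintype.piFinset fun k => if (k : ℕ) < N p then {x p k} else Finset.univ with hS
  have hcard : ∀ p ∈ P, (S p).card = n ^ (M - N p) := by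
    intro p hp
    rw [hS, Fintype.card_piFinset]
    have : ∀ k : Fin M, (if (k : ℕ) < N p then ({x p k} : Finset (Fin n)) else Finset.univ).card
        = if (k : ℕ) < N p then 1 else n := fun k => by split_ifs <;> simp
    simp_rw [this]
    rw [Fin.prod_univ_eq_prod_range (fun k => if k < N p then 1 else n) M,
      ← Finset.prod_range_mul_prod_Ico _ (hNM p hp)]
    rw [Finset.prod_congr rfl fun k hk => if_pos (Finset.mem_range.1 hk),
      Finset.prod_congr rfl fun k hk => if_neg (not_lt.2 (Finset.mem_Ico.1 hk).1)]
    simp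
  have hd : (P : Set ι).PairwiseDisjoint S := by
    intro p hp q hq hpq
    refine Finset.disjoint_left.2 fun v hvp hvq => hdisj p hp q hq hpq ?_
    have key : ∀ p, v ∈ S p → ∀ k (hk : k < M), k < N p → v ⟨k, hk⟩ = x p k := by
      intro p hv k hk hkp
      have := Fintype.mem_piFinset.1 hv ⟨k, hk⟩
      simpa [hkp] using this
    refine ⟨fun k => if hk : k < M then v ⟨k, hk⟩ else x p k, fun k hk => ?_, fun k hk => ?_⟩
    · have hkM := hk.trans_le (hNM p hp)
      simp only [hkM, dite_true]
      exact key p hvp k hkM hk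
    · have hkM := hk.trans_le (hNM q hq)
      simp only [hkM, dite_true]
      exact key q hvq k hkM hk
  have htot : ∑ p ∈ P, n ^ (M - N p) ≤ n ^ M := by
    rw [← Finset.sum_congr rfl hcard, ← Finset.card_biUnion hd]
    refine (Finset.card_le_univ _).trans (by simp)
  have hn' : (0 : ℝ) < n := by exact_mod_cast hn
  have hpow : (0 : ℝ) < (n : ℝ) ^ M := by positivity
  refine le_of_mul_le_mul_left ?_ hpow
  rw [Finset.mul_sum, mul_one]
  rw [← Finset.sum_congr rfl fun p hp => pow_sub₀ _ hn'.ne' (hNM p hp)]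
  exact_mod_cast htot

/-- A disk of radius `ρ` centred on the coded set contains the image of a cylinder of measure
comparable to `ρ ^ s`, so Kraft's inequality bounds `∑ ρ ^ s` over disjoint disks. -/
theorem IsCantorCoding.packingSup_le {n : ℕ} {r c C : ℝ} {π : (ℕ → Fin n) → ℂ}
    (h : IsCantorCoding r c C π) (hr : 0 < r) (hr1 : r < 1) (hC : 0 < C)
    {s t : ℝ} (hs : 0 ≤ s) (hst : s ≤ t) (hrs : r ^ s = (n : ℝ)⁻¹) {δ : ℝ} (hδ : 0 < δ)
    (hδC : δ ≤ C) :
    packingSup t δ (range π) ≤ ENNReal.ofReal ((2 * C / r) ^ s * δ ^ (t - s)) := by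
  refine iSup₂_le fun P hP => ?_
  have hex : ∀ p : ℂ × ℝ, ∃ x : ℕ → Fin n, ∃ N : ℕ, p ∈ P →
      π x = p.1 ∧ C * r ^ N ≤ p.2 ∧ 2 * p.2 ≤ (2 * C / r) * r ^ N := by
    intro p
    by_cases hp : p ∈ P
    · obtain ⟨⟨x, hx⟩, hρ, hρδ⟩ := hP.1 p hp
      obtain ⟨N, h1, h2⟩ := exists_nat_pow_near_of_lt_one (x := p.2 / C) (by positivity)
        (by rw [div_le_one hC]; linarith) hr hr1
      -- `N + 1` is the least length at which the diameter bound for cylinders is below the radius.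
      refine ⟨x, N + 1, fun _ => ⟨hx, ?_, ?_⟩⟩
      · rw [lt_div_iff₀ hC] at h1
        linarith
      · rw [div_le_iff₀ hC] at h2
        rw [pow_succ]
        field_simp
        linarith
    · obtain ⟨x⟩ : Nonempty (ℕ → Fin n) := by
        rcases Nat.eq_zero_or_pos n with rfl | hn
        · exfalso
          have : 0 < r ^ s := by positivity
          simp [hrs] at this
        · exact ⟨fun _ => ⟨0, hn⟩⟩
      exact ⟨x, 0, fun h => absurd h hp⟩
  choose x N hxN using hex
  have hkraft := sum_inv_pow_le_one P x N (by
    rintro p hp q hq hpq ⟨y, hyp, hyq⟩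
    have hdisj : Disjoint (closedBall p.1 p.2) (closedBall q.1 q.2) := hP.2 hp hq hpq
    refine Set.disjoint_left.1 hdisj (?_ : π y ∈ _) ?_
    · rw [mem_closedBall, ← (hxN p hp).1]
      exact (h.upper _ _ _ hyp).trans (hxN p hp).2.1
    · rw [mem_closedBall, ← (hxN q hq).1]
      exact (h.upper _ _ _ hyq).trans (hxN q hq).2.1)
  rw [← ENNReal.ofReal_sum_of_nonneg fun p hp => by
    have := (hP.1 p hp).2.1
    positivity]
  refine ENNReal.ofReal_le_ofReal ?_
  calc ∑ p ∈ P, (2 * p.2) ^ t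
      ≤ ∑ p ∈ P, (2 * C / r) ^ s * δ ^ (t - s) * ((n : ℝ) ^ N p)⁻¹ := by
        refine Finset.sum_le_sum fun p hp => ?_
        obtain ⟨-, hρ, hρδ⟩ := hP.1 p hp
        have h1 : (2 * p.2) ^ s ≤ (2 * C / r) ^ s * ((n : ℝ) ^ N p)⁻¹ := by
          rw [← inv_pow, ← hrs, ← Real.rpow_natCast (r ^ s), ← Real.rpow_mul hr.le, mul_comm s,
            Real.rpow_mul hr.le, Real.rpow_natCast, ← Real.mul_rpow (by positivity) (by positivity)]
          exact Real.rpow_le_rpow (by positivity) (hxN p hp).2.2 hs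
        have h2 : (2 * p.2) ^ (t - s) ≤ δ ^ (t - s) :=
          Real.rpow_le_rpow (by positivity) hρδ (by linarith)
        calc (2 * p.2) ^ t = (2 * p.2) ^ s * (2 * p.2) ^ (t - s) := by
              rw [← Real.rpow_add (by positivity)]
              congr 1
              ring
          _ ≤ ((2 * C / r) ^ s * ((n : ℝ) ^ N p)⁻¹) * δ ^ (t - s) := by gcongr
          _ = _ := by ring
    _ = (2 * C / r) ^ s * δ ^ (t - s) * ∑ p ∈ P, ((n : ℝ) ^ N p)⁻¹ := by rw [Finset.mul_sum]
    _ ≤ (2 * C / r) ^ s * δ ^ (t - s) := by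
        exact mul_le_of_le_one_right (by positivity) hkraft

theorem IsCantorCoding.prePackingMeasure_eq_zero {n : ℕ} {r c C : ℝ} {π : (ℕ → Fin n) → ℂ}
    (h : IsCantorCoding r c C π) (hr : 0 < r) (hr1 : r < 1) (hC : 0 < C)
    {s t : ℝ} (hs : 0 ≤ s) (hst : s < t) (hrs : r ^ s = (n : ℝ)⁻¹) :
    prePackingMeasure t (range π) = 0 :=
  prePackingMeasure_eq_zero_of_le (sub_pos.2 hst) hC fun _ hδ hδC =>
    h.packingSup_le hr hr1 hC hs hst.le hrs hδ hδC


/-! ### Expansions in a complex base -/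

/-- The point `∑ aᵏ b(xₖ)` with base `a` and digits `b`; over all words `x` these points form the
attractor of the similarities `z ↦ a z + b i`. -/
noncomputable def expansion {n : ℕ} (a : ℂ) (b : Fin n → ℂ) (x : ℕ → Fin n) : ℂ :=
  ∑' k, a ^ k * b (x k)

theorem summable_pow_mul_of_bounded {a : ℂ} (ha : ‖a‖ ≤ 1 / 2) {e : ℕ → ℂ} {M : ℝ}
    (he : ∀ k, ‖e k‖ ≤ M) : Summable fun k => a ^ k * e k := by
  refine Summable.of_norm_bounded (g := fun k => M * (1 / 2 : ℝ) ^ k)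
    ((summable_geometric_of_lt_one (by norm_num) (by norm_num)).mul_left M) fun k => ?_
  rw [norm_mul, norm_pow, mul_comm]
  exact mul_le_mul (he k) (pow_le_pow_left₀ (norm_nonneg _) ha k) (by positivity)
    ((norm_nonneg _).trans (he k))

theorem norm_tsum_pow_mul_le {a : ℂ} (ha : ‖a‖ ≤ 1 / 2) {e : ℕ → ℂ} {M : ℝ} {N : ℕ}
    (he : ∀ k, ‖e k‖ ≤ M) (h0 : ∀ k < N, e k = 0) :
    ‖∑' k, a ^ k * e k‖ ≤ 2 * M * ‖a‖ ^ N := by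
  have hsum := summable_pow_mul_of_bounded ha he
  rw [← hsum.sum_add_tsum_nat_add N, Finset.sum_eq_zero fun k hk => by
    rw [h0 k (Finset.mem_range.1 hk), mul_zero], zero_add]
  have hg : HasSum (fun k : ℕ => M * ‖a‖ ^ N * (1 / 2 : ℝ) ^ k) (M * ‖a‖ ^ N * 2) :=
    hasSum_geometric_two.mul_left _
  refine (tsum_of_norm_bounded hg fun k => ?_).trans (le_of_eq (by ring))
  rw [norm_mul, norm_pow, pow_add]
  have h1 : ‖a‖ ^ k ≤ (1 / 2) ^ k := pow_le_pow_left₀ (norm_nonneg _) ha k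
  have hM : 0 ≤ M := (norm_nonneg _).trans (he 0)
  calc ‖a‖ ^ k * ‖a‖ ^ N * ‖e (k + N)‖ ≤ (1 / 2) ^ k * ‖a‖ ^ N * M := by
        gcongr
        exact he _
    _ = _ := by ring

section Expansion
variable {n : ℕ} {a : ℂ} {b : Fin n → ℂ} {β : ℝ}

theorem norm_expansion_le (ha : ‖a‖ ≤ 1 / 2) (hb : ∀ i, ‖b i‖ ≤ β) (x : ℕ → Fin n) :
    ‖expansion a b x‖ ≤ 2 * β := by
  simpa [expansion] using norm_tsum_pow_mul_le (N := 0) ha (fun k => hb (x k)) (by simp)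

theorem continuous_expansion (ha : ‖a‖ ≤ 1 / 2) (hb : ∀ i, ‖b i‖ ≤ β) :
    Continuous (expansion a b) := by
  refine continuous_tsum (u := fun k => β * (1 / 2 : ℝ) ^ k) (fun k => ?_)
    ((summable_geometric_of_lt_one (by norm_num) (by norm_num)).mul_left β) fun k x => ?_
  · exact continuous_const.mul (continuous_of_discreteTopology.comp (continuous_apply k))
  · rw [norm_mul, norm_pow, mul_comm]
    exact mul_le_mul (hb _) (pow_le_pow_left₀ (norm_nonneg _) ha k) (by positivity)
      ((norm_nonneg _).trans (hb (x k)))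

theorem differentiableOn_expansion {U : Set ℂ} (hU : IsOpen U) {a : ℂ → ℂ}
    (hd : DifferentiableOn ℂ a U) (ha : ∀ w ∈ U, ‖a w‖ ≤ 1 / 2) (hb : ∀ i, ‖b i‖ ≤ β)
    (x : ℕ → Fin n) : DifferentiableOn ℂ (fun w => expansion (a w) b x) U := by
  refine Complex.differentiableOn_tsum_of_summable_norm (u := fun k => β * (1 / 2 : ℝ) ^ k)
    ((summable_geometric_of_lt_one (by norm_num) (by norm_num)).mul_left β)
    (fun k => (hd.pow k).mul_const _) hU fun k w hw => ?_
  rw [norm_mul, norm_pow, mul_comm]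
  exact mul_le_mul (hb _) (pow_le_pow_left₀ (norm_nonneg _) (ha w hw) k) (by positivity)
    ((norm_nonneg _).trans (hb (x k)))

/-- If the base is small compared with the separation of the digits, then the first digit at which
two expansions differ determines their distance up to a constant factor. -/
theorem isCantorCoding_expansion {μ : ℝ} (ha : ‖a‖ ≤ 1 / 2) (hb : ∀ i, ‖b i‖ ≤ β)
    (hsep : ∀ i j, i ≠ j → μ ≤ ‖b i - b j‖) (haμ : 8 * β * ‖a‖ ≤ μ) :
    IsCantorCoding ‖a‖ (μ / 2) (4 * β) (expansion a b) := by
  have hdiff : ∀ x y, dist (expansion a b x) (expansion a b y) =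
      ‖∑' k, a ^ k * (b (x k) - b (y k))‖ := fun x y => by
    rw [dist_eq_norm, expansion, expansion,
      ← (summable_pow_mul_of_bounded ha fun k => hb (x k)).tsum_sub
        (summable_pow_mul_of_bounded ha fun k => hb (y k))]
    simp_rw [mul_sub]
  have hbd : ∀ i j, ‖b i - b j‖ ≤ 2 * β := fun i j =>
    (norm_sub_le _ _).trans (by linarith [hb i, hb j])
  refine ⟨fun x y N hN hne => ?_, fun x y N hN => ?_⟩
  · rw [hdiff]
    set e : ℕ → ℂ := fun k => b (x k) - b (y k) with he
    have hβ : 0 ≤ β := (norm_nonneg _).trans (hb (x 0))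
    have he' : ∀ k, ‖Function.update e N 0 k‖ ≤ 2 * β := fun k => by
      rcases eq_or_ne k N with rfl | hk
      · simpa using hβ
      · rw [Function.update_of_ne hk]
        exact hbd _ _
    have h0 : ∀ k < N + 1, Function.update e N 0 k = 0 := fun k hk => by
      rcases eq_or_ne k N with rfl | hkN
      · simp
      · rw [Function.update_of_ne hkN, he]
        simp only
        rw [hN k (by lia), sub_self]
    have htail := norm_tsum_pow_mul_le ha he' h0
    have hsplit : ∑' k, a ^ k * e k = a ^ N * e N + ∑' k, a ^ k * Function.update e N 0 k := by
      rw [← sub_eq_iff_eq_add, ← (summable_pow_mul_of_bounded ha fun k => hbd _ _).tsum_sub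
        (summable_pow_mul_of_bounded ha he'), tsum_eq_single N]
      · simp [he]
      · intro k hk
        rw [Function.update_of_ne hk]
        exact sub_self _
    change _ ≤ ‖∑' k, a ^ k * e k‖
    rw [hsplit]
    have h1 : ‖a ^ N * e N‖ ≥ ‖a‖ ^ N * μ := by
      rw [norm_mul, norm_pow]
      exact mul_le_mul_of_nonneg_left (hsep _ _ hne) (by positivity)
    have h2 := norm_sub_le_norm_add (a ^ N * e N) (∑' k, a ^ k * Function.update e N 0 k)
    have h3 : 2 * (2 * β) * ‖a‖ ^ (N + 1) ≤ ‖a‖ ^ N * (μ / 2) := by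
      rw [pow_succ]
      have := mul_le_mul_of_nonneg_left haμ (pow_nonneg (norm_nonneg a) N)
      linarith
    linarith
  · rw [hdiff]
    refine (norm_tsum_pow_mul_le ha (fun k => hbd _ _) fun k hk => ?_).trans (le_of_eq (by ring))
    rw [hN k hk, sub_self]

end Expansion

/-- The `m²` points of the unit square with coordinates in `{0, 1 / m, …, (m - 1) / m}`. -/
noncomputable def gridPoint (m : ℕ) (i : Fin (m * m)) : ℂ :=
  ⟨((i / m : ℕ) : ℝ) / m, ((i % m : ℕ) : ℝ) / m⟩

theorem norm_gridPoint_le (m : ℕ) (i : Fin (m * m)) : ‖gridPoint m i‖ ≤ 2 := by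
  have hm : 0 < m := Nat.pos_of_mul_pos_left i.pos
  have hm' : (0 : ℝ) < m := by exact_mod_cast hm
  refine (Complex.norm_le_abs_re_add_abs_im _).trans ?_
  have h1 : |(gridPoint m i).re| ≤ 1 := by
    change |((i / m : ℕ) : ℝ) / m| ≤ 1
    rw [abs_of_nonneg (by positivity), div_le_one hm']
    exact_mod_cast (Nat.div_lt_of_lt_mul i.2).le
  have h2 : |(gridPoint m i).im| ≤ 1 := by
    change |((i % m : ℕ) : ℝ) / m| ≤ 1
    rw [abs_of_nonneg (by positivity), div_le_one hm']
    exact_mod_cast (Nat.mod_lt _ hm).le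
  linarith

theorem gridPoint_separated {m : ℕ} {i j : Fin (m * m)} (hij : i ≠ j) :
    1 / (m : ℝ) ≤ ‖gridPoint m i - gridPoint m j‖ := by
  have key : ∀ p q : ℕ, p ≠ q → 1 / (m : ℝ) ≤ |(p : ℝ) / m - (q : ℝ) / m| := by
    intro p q hpq
    rw [← sub_div, abs_div, Nat.abs_cast]
    gcongr
    have h1 : (1 : ℤ) ≤ |(p : ℤ) - q| := Int.one_le_abs (by lia)
    exact_mod_cast h1
  by_cases h : (i / m : ℕ) = j / m
  · have h' : (i % m : ℕ) ≠ j % m := fun h' => hij <| Fin.ext <| by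
      rw [← Nat.div_add_mod (i : ℕ) m, ← Nat.div_add_mod (j : ℕ) m, h, h']
    exact (key _ _ h').trans (Complex.abs_im_le_norm (gridPoint m i - gridPoint m j))
  · exact (key _ _ h).trans (Complex.abs_re_le_norm (gridPoint m i - gridPoint m j))

/-! ### Countably many holomorphic functions determining the infimum -/

theorem IsInfHarmonicOn.exists_seq_holomorphic {u : ℂ → ℝ} (hu : IsInfHarmonicOn u unitDisk) :
    ∃ g : ℕ → ℂ → ℂ, (∀ k, DifferentiableOn ℂ (g k) unitDisk) ∧
      ∀ w ∈ unitDisk, IsGLB (range fun k => (g k w).re) (u w) := by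
  obtain ⟨-, H, hH, hglb⟩ := hu
  have hX : IsGLB (unitDisk.domRestrict '' H) (unitDisk.domRestrict u) := by
    rw [isGLB_pi]
    intro w
    rw [image_image]
    exact hglb w w.2
  obtain ⟨F, hFH, hFc, hF⟩ := exists_countable_upperSemicontinuous_isGLB (by
    rintro _ ⟨h, hh, rfl⟩
    exact (continuousOn_iff_continuous_domRestrict.1 (hH h hh).continuousOn).upperSemicontinuous) hX
  rw [isGLB_pi] at hF
  have hne : F.Nonempty := by
    simpa using (hF ⟨0, mem_ball_self one_pos⟩).nonempty
  obtain ⟨f, rfl⟩ := hFc.exists_eq_range hne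
  have hex : ∀ k, ∃ g : ℂ → ℂ, DifferentiableOn ℂ g unitDisk ∧
      ∀ w : unitDisk, (g w).re = f k w := by
    intro k
    obtain ⟨h, hh, hhk⟩ := hFH (mem_range_self k)
    obtain ⟨g, hg, hgh⟩ := (hH h hh).exists_analyticOnNhd_ball_re_eq
    exact ⟨g, hg.differentiableOn, fun w => by rw [← hhk]; exact hgh w.2⟩
  choose g hg hgf using hex
  refine ⟨g, hg, fun w hw => ?_⟩
  have := hF ⟨w, hw⟩
  rw [← range_comp] at this
  simp only [hgf _ ⟨w, hw⟩]
  exact this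

/-- The functions can be chosen to stay uniformly above the infimum, by adding the constants
`1 / (i + 1)`. -/
theorem IsInfHarmonicOn.exists_seq_holomorphic_add_le {u : ℂ → ℝ}
    (hu : IsInfHarmonicOn u unitDisk) :
    ∃ (g : ℕ → ℂ → ℂ) (ε : ℕ → ℝ), (∀ k, DifferentiableOn ℂ (g k) unitDisk) ∧ (∀ k, 0 < ε k) ∧
      ∀ w ∈ unitDisk, (∀ k, u w + ε k ≤ (g k w).re) ∧ ∀ v, u w < v → ∃ k, (g k w).re < v := by
  obtain ⟨g, hg, hglb⟩ := hu.exists_seq_holomorphic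
  refine ⟨fun k w => g k.unpair.1 w + ((1 / ((k.unpair.2 : ℝ) + 1) : ℝ) : ℂ),
    fun k => 1 / ((k.unpair.2 : ℝ) + 1), fun k => (hg _).add_const _, fun k => by positivity,
    fun w hw => ⟨fun k => ?_, fun v hv => ?_⟩⟩
  · rw [Complex.add_re, Complex.ofReal_re]
    gcongr
    exact (hglb w hw).1 (mem_range_self _)
  · obtain ⟨_, ⟨j, rfl⟩, hj⟩ := (isGLB_lt_iff (hglb w hw)).1 hv
    obtain ⟨i, hi⟩ := exists_nat_one_div_lt (sub_pos.2 hj)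
    refine ⟨Nat.pair j i, ?_⟩
    rw [Complex.add_re, Complex.ofReal_re, Nat.unpair_pair]
    simp only at hi ⊢
    linarith

/-! ### Assembling the motion -/

/-- A holomorphic family of injective parametrizations of sets yields a holomorphic motion of the
set at parameter `0`: the point with index `i` moves along `w ↦ Φ w i`. -/
theorem isHolomorphicMotion_of_parametrization {I : Type*} [Nonempty I] {Φ : ℂ → I → ℂ}
    (hol : ∀ i, DifferentiableOn ℂ (fun w => Φ w i) unitDisk)
    (inj : ∀ w ∈ unitDisk, Function.Injective (Φ w)) :
    IsHolomorphicMotion (range (Φ 0)) (fun w z => Φ w (Function.invFun (Φ 0) z)) ∧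
      ∀ w, (fun z => Φ w (Function.invFun (Φ 0) z)) '' range (Φ 0) = range (Φ w) := by
  have hinv : ∀ i, Function.invFun (Φ 0) (Φ 0 i) = i :=
    Function.leftInverse_invFun (inj 0 (mem_ball_self one_pos))
  refine ⟨⟨?_, ?_, ?_⟩, fun w => ?_⟩
  · rintro _ ⟨i, rfl⟩
    exact hol _
  · rintro w hw _ ⟨i, rfl⟩ _ ⟨j, rfl⟩ hij
    simp only [hinv] at hij
    rw [inj w hw hij]
  · rintro _ ⟨i, rfl⟩
    simp only [hinv]
  · rw [← range_comp]
    congr 1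
    ext i
    simp only [Function.comp, hinv]

open Filter Topology in
theorem isCompact_insert_iUnion {K : ℕ → Set ℂ} (hK : ∀ k, IsCompact (K k)) {ρ : ℕ → ℝ}
    (hρ : Tendsto ρ atTop (𝓝 0)) {z : ℂ} (hKρ : ∀ k, K k ⊆ closedBall z (ρ k)) :
    IsCompact (insert z (⋃ k, K k)) := by
  rw [isCompact_iff_ultrafilter_le_nhds]
  intro f hf
  by_cases h : ∃ k, K k ∈ f
  · obtain ⟨k, hk⟩ := h
    obtain ⟨x, hx, hfx⟩ := isCompact_iff_ultrafilter_le_nhds.1 (hK k) f (le_principal_iff.2 hk)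
    exact ⟨x, mem_insert_of_mem _ (mem_iUnion_of_mem k hx), hfx⟩
  · push Not at h
    refine ⟨z, mem_insert _ _, ?_⟩
    rw [nhds_basis_closedBall.ge_iff]
    intro ε hε
    obtain ⟨k₀, hk₀⟩ := eventually_atTop.1 (hρ.eventually_le_const hε)
    have hfin : ∀ᶠ x in (f : Filter ℂ), ∀ k ∈ Finset.range k₀, x ∉ K k :=
      (Finset.eventually_all _).2 fun k _ => Ultrafilter.compl_mem_iff_notMem.2 (h k)
    filter_upwards [hfin, le_principal_iff.1 hf] with x hx hxA
    rcases hxA with rfl | hxA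
    · exact mem_closedBall_self hε.le
    · obtain ⟨k, hk⟩ := mem_iUnion.1 hxA
      have : k₀ ≤ k := by
        by_contra! hlt
        exact hx k (Finset.mem_range.2 hlt) hk
      exact closedBall_subset_closedBall (hk₀ k this) (hKρ k hk)

/-- The disks `D(2⁻ᵏ, 2⁻ᵏ / 16)` are pairwise disjoint. -/
theorem eq_of_dist_half_pow_le {k l : ℕ} {z : ℂ}
    (hk : dist z (((1 / 2) ^ k : ℝ) : ℂ) ≤ (1 / 2) ^ k / 16)
    (hl : dist z (((1 / 2) ^ l : ℝ) : ℂ) ≤ (1 / 2) ^ l / 16) : k = l := by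
  wlog hkl : k < l generalizing k l
  · rcases lt_trichotomy k l with h | h | h
    · exact this hk hl h
    · exact h
    · exact (this hl hk h).symm
  exfalso
  have h1 := dist_triangle_left (((1 / 2) ^ k : ℝ) : ℂ) (((1 / 2) ^ l : ℝ) : ℂ) z
  rw [Complex.dist_of_im_eq (by rw [Complex.ofReal_im, Complex.ofReal_im]), Complex.ofReal_re,
    Complex.ofReal_re, Real.dist_eq] at h1
  have h2 : (1 / 2 : ℝ) ^ l ≤ (1 / 2) ^ (k + 1) :=
    pow_le_pow_of_le_one (by norm_num) (by norm_num) hkl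
  rw [pow_succ] at h2
  have h3 := le_abs_self ((1 / 2 : ℝ) ^ k - (1 / 2) ^ l)
  have h4 : (0 : ℝ) < (1 / 2) ^ k := by positivity
  linarith

/-- Grids are fine enough, for a base of modulus `m ^ (-2 h)` with `h ≥ 1 / 2 + ε`, once `m` is
large in terms of `ε`. -/
theorem exists_grid_size {ε : ℝ} (hε : 0 < ε) :
    ∃ m : ℕ, 1 < m ∧ ∀ h : ℝ, 1 / 2 + ε ≤ h →
      Real.exp (-(2 * Real.log m) * h) ≤ 1 / 2 ∧
      8 * 2 * Real.exp (-(2 * Real.log m) * h) ≤ 1 / m := by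
  have ht : Filter.Tendsto (fun m : ℕ => Real.log m) Filter.atTop Filter.atTop :=
    Real.tendsto_log_atTop.comp tendsto_natCast_atTop_atTop
  obtain ⟨m, hm, hm1⟩ := ((ht.eventually_ge_atTop (Real.log 16 / (2 * ε))).and
    (Filter.eventually_gt_atTop 1)).exists
  have hm' : (1 : ℝ) < m := by exact_mod_cast hm1
  have hlog : 0 < Real.log m := Real.log_pos hm'
  refine ⟨m, hm1, fun h hh => ?_⟩
  have h1 : 8 * 2 * Real.exp (-(2 * Real.log m) * h) ≤ 1 / m := by
    rw [div_le_iff₀ (by positivity)] at hm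
    have h2 : Real.exp (-(2 * Real.log m) * h) ≤ Real.exp (-Real.log 16 + -Real.log m) := by
      apply Real.exp_le_exp.2
      nlinarith
    rw [Real.exp_add, Real.exp_neg, Real.exp_neg, Real.exp_log (by norm_num),
      Real.exp_log (by linarith)] at h2
    rw [one_div]
    linarith
  refine ⟨?_, h1⟩
  have : 1 / (m : ℝ) ≤ 1 := by rw [div_le_one (by linarith)]; exact hm'.le
  linarith

end HoloMotion

open HoloMotion Filter Topology in
theorem theorem1p7 (d : ℂ → ℝ)
    (hd : ∀ w ∈ HoloMotion.unitDisk, 0 < d w ∧ d w ≤ 2)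
    (hinf : HoloMotion.IsInfHarmonicOn (fun w => 1 / d w) HoloMotion.unitDisk) :
    ∃ (A : Set ℂ) (f : ℂ → ℂ → ℂ),
      IsCompact A ∧ HoloMotion.IsHolomorphicMotion A f ∧
        ∀ w ∈ HoloMotion.unitDisk,
          HoloMotion.packingDim (f w '' A) = ENNReal.ofReal (d w) ∧
            dimH (f w '' A) = ENNReal.ofReal (d w) := by
  obtain ⟨g, ε, hg, hε, hgu⟩ := hinf.exists_seq_holomorphic_add_le
  choose m hm1 hm using fun k => exists_grid_size (hε k)
  -- The base with `|a k w| = m ^ (-2 Re (g k w))`, so that `m²` digits give dimension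
  -- `1 / Re (g k w)`.
  set a : ℕ → ℂ → ℂ := fun k w => Complex.exp ((-(2 * Real.log (m k)) : ℝ) * g k w)
  have ha_norm : ∀ k w, ‖a k w‖ = Real.exp (-(2 * Real.log (m k)) * (g k w).re) := fun k w => by
    rw [Complex.norm_exp, Complex.re_ofReal_mul]
  have hre : ∀ k, ∀ w ∈ unitDisk, 1 / 2 + ε k ≤ (g k w).re := fun k w hw => by
    have h1 := one_div_le_one_div_of_le (hd w hw).1 (hd w hw).2
    have h2 := (hgu w hw).1 k
    linarith
  have hre_pos : ∀ k, ∀ w ∈ unitDisk, 0 < (g k w).re := fun k w hw => by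
    linarith [hre k w hw, hε k]
  have ha0 : ∀ k w, 0 < ‖a k w‖ := fun k w => by rw [ha_norm]; positivity
  have ha : ∀ k, ∀ w ∈ unitDisk, ‖a k w‖ ≤ 1 / 2 := fun k w hw => by
    rw [ha_norm]
    exact (hm k _ (hre k w hw)).1
  have hm0 : ∀ k, (0 : ℝ) < m k := fun k => by exact_mod_cast zero_lt_one.trans (hm1 k)
  set Ψ : ℂ → (k : ℕ) → (ℕ → Fin (m k * m k)) → ℂ := fun w k x =>
    (((1 / 2) ^ k : ℝ) : ℂ) + ((1 / 64 * (1 / 2) ^ k : ℝ) : ℂ) *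
      expansion (a k w) (gridPoint (m k)) x
    with hΨ
  have hcode : ∀ k, ∀ w ∈ unitDisk, ∃ c C, 0 < c ∧ 0 < C ∧ IsCantorCoding ‖a k w‖ c C (Ψ w k) := by
    intro k w hw
    have h := isCantorCoding_expansion (ha k w hw) (norm_gridPoint_le (m k))
      (fun i j => gridPoint_separated) (by rw [ha_norm]; exact (hm k _ (hre k w hw)).2)
    have := hm0 k
    exact ⟨_, _, by positivity, by positivity,
      h.affine (((1 / 2) ^ k : ℝ) : ℂ) (σ := 1 / 64 * (1 / 2) ^ k) (by positivity)⟩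
  have hball : ∀ k, ∀ w ∈ unitDisk, ∀ x,
      dist (Ψ w k x) (((1 / 2) ^ k : ℝ) : ℂ) ≤ (1 / 2) ^ k / 16 := by
    intro k w hw x
    rw [hΨ, dist_eq_norm, add_sub_cancel_left, norm_mul, Complex.norm_real,
      Real.norm_of_nonneg (by positivity)]
    have h1 := norm_expansion_le (ha k w hw) (norm_gridPoint_le (m k)) x
    have h2 : (0 : ℝ) < (1 / 2) ^ k := by positivity
    nlinarith
  -- The index `none` stands for the accumulation point `0`, which does not move.
  set Φ : ℂ → Option (Σ k, ℕ → Fin (m k * m k)) → ℂ := fun w i => i.elim 0 fun p => Ψ w p.1 p.2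
  have hrange : ∀ w, range (Φ w) = insert 0 (⋃ k, range (Ψ w k)) := by
    intro w
    ext z
    simp only [mem_range, Option.exists, Sigma.exists, mem_insert_iff, mem_iUnion, eq_comm (a := z)]
    rfl
  have hcompact : ∀ w ∈ unitDisk, IsCompact (range (Φ w)) := by
    intro w hw
    rw [hrange]
    have ht : Tendsto (fun k : ℕ => 2 * (1 / 2 : ℝ) ^ k) atTop (𝓝 0) := by
      simpa using (tendsto_pow_atTop_nhds_zero_of_lt_one (r := (1 / 2 : ℝ)) (by norm_num)
        (by norm_num)).const_mul 2
    refine isCompact_insert_iUnion (fun k => isCompact_range ?_) ht fun k => ?_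
    · exact continuous_const.add (continuous_const.mul
        (continuous_expansion (ha k w hw) (norm_gridPoint_le (m k))))
    · rintro _ ⟨x, rfl⟩
      have h1 := hball k w hw x
      have h2 : dist (((1 / 2) ^ k : ℝ) : ℂ) 0 = (1 / 2) ^ k := by
        rw [dist_zero_right, Complex.norm_real, Real.norm_of_nonneg (by positivity)]
      have h3 := dist_triangle (Ψ w k x) (((1 / 2) ^ k : ℝ) : ℂ) 0
      have h4 : (0 : ℝ) < (1 / 2) ^ k := by positivity
      rw [mem_closedBall]
      linarith
  obtain ⟨hmotion, himage⟩ := isHolomorphicMotion_of_parametrization (Φ := Φ) (by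
      rintro (_ | ⟨k, x⟩)
      · exact differentiableOn_const 0
      · exact (differentiableOn_const _).add ((differentiableOn_const _).mul
          (differentiableOn_expansion isOpen_ball ((hg k).const_mul _).cexp (ha k)
            (norm_gridPoint_le (m k)) x))) (by
      intro w hw
      have h0 : ∀ k x, Ψ w k x ≠ 0 := fun k x h => by
        have h1 := hball k w hw x
        rw [h, dist_zero_left, Complex.norm_real, Real.norm_of_nonneg (by positivity)] at h1
        have h2 : (0 : ℝ) < (1 / 2) ^ k := by positivity
        linarith
      rintro (_ | ⟨k, x⟩) (_ | ⟨l, y⟩) h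
      · rfl
      · exact absurd h.symm (h0 l y)
      · exact absurd h (h0 k x)
      · change Ψ w k x = Ψ w l y at h
        obtain rfl := eq_of_dist_half_pow_le (hball k w hw x) (h ▸ hball l w hw y)
        obtain ⟨c, C, hc, -, hcod⟩ := hcode k w hw
        rw [hcod.injective (ha0 k w) hc h])
  refine ⟨_, _, hcompact 0 (mem_ball_self one_pos), hmotion, fun w hw => ?_⟩
  rw [himage]
  have hpow : ∀ k, ‖a k w‖ ^ (1 / (g k w).re) = ((m k * m k : ℕ) : ℝ)⁻¹ := fun k => by
    rw [ha_norm, ← Real.exp_mul, mul_assoc, mul_one_div_cancel (hre_pos k w hw).ne', mul_one,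
      two_mul, neg_add, Real.exp_add, Real.exp_neg, Real.exp_log (hm0 k)]
    push_cast
    rw [mul_inv]
  have hle : packingDim (range (Φ w)) ≤ ENNReal.ofReal (d w) := by
    rw [hrange]
    refine packingDim_insert_iUnion_le 0 _ fun s hs k => ?_
    obtain ⟨c, C, -, hC, hcod⟩ := hcode k w hw
    refine hcod.prePackingMeasure_eq_zero (ha0 k w) ((ha k w hw).trans_lt (by norm_num)) hC
      (one_div_pos.2 (hre_pos k w hw)).le ?_ (hpow k)
    have h1 : d w < s := by
      rwa [← ENNReal.ofReal_coe_nnreal, ENNReal.ofReal_lt_ofReal_iff_of_nonneg (hd w hw).1.le]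
        at hs
    refine lt_of_le_of_lt ?_ h1
    rw [one_div_le (hre_pos k w hw) (hd w hw).1]
    linarith [(hgu w hw).1 k, hε k]
  have hge : ENNReal.ofReal (d w) ≤ dimH (range (Φ w)) := by
    refine le_of_forall_lt fun q hq => ?_
    have hq' : q ≠ ∞ := (hq.trans ENNReal.ofReal_lt_top).ne
    obtain ⟨t, ht0, htd, hqt⟩ : ∃ t, 0 < t ∧ t < d w ∧ q < ENNReal.ofReal t := by
      obtain ⟨t, h1, h2⟩ := exists_between ((ENNReal.lt_ofReal_iff_toReal_lt hq').1 hq)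
      exact ⟨t, ENNReal.toReal_nonneg.trans_lt h1, h2, (ENNReal.lt_ofReal_iff_toReal_lt hq').2 h1⟩
    obtain ⟨k, hk⟩ := (hgu w hw).2 (1 / t) (one_div_lt_one_div_of_lt ht0 htd)
    obtain ⟨c, C, hc, -, hcod⟩ := hcode k w hw
    have h1 := hcod.le_dimH (Nat.one_lt_mul_iff.2 ⟨zero_lt_one.trans (hm1 k),
      zero_lt_one.trans (hm1 k), Or.inl (hm1 k)⟩) (ha0 k w) hc
      (one_div_pos.2 (hre_pos k w hw)) (hpow k)
    calc q < ENNReal.ofReal t := hqt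
      _ ≤ ENNReal.ofReal (1 / (g k w).re) := by
          refine ENNReal.ofReal_le_ofReal ?_
          rw [le_one_div ht0 (hre_pos k w hw)]
          exact hk.le
      _ ≤ dimH (range (Ψ w k)) := h1
      _ ≤ dimH (range (Φ w)) := dimH_mono <| by
          rw [hrange]
          exact (subset_iUnion (fun k => range (Ψ w k)) k).trans (subset_insert _ _)
  have hHP := dimH_le_packingDim (hcompact w hw).isBounded
  exact ⟨hle.antisymm (hge.trans hHP), (hHP.trans hle).antisymm hge⟩
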